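/- Let $\|\cdot\|$ be any norm on $\mathbb{R}^n$, let $f:\mathbb{R}^n\to\mathbb{R}^n$ be $C^1$, and suppose that for every $x\in\mathbb{R}^n$ the system $\dot x=f(x)$ has a solution $t\mapsto\phi_t(x)$ with $\phi_0(x)=x$ defined for all $t\ge 0$. Suppose that the system is nonexpansive with respect to $\|\cdot\|$, that is, $\|\phi_t(x)-\phi_t(y)\|\le\|x-y\|$ for all $t>0$ and all $x,y\in\mathbb{R}^n$. By the trajectory of $x$ we mean the set $\{\phi_t(x): t\ge 0\}$. (1) Exactly one of the following two conditions holds: (a) every trajectory of the system is unbounded; (b) the system has an equilibrium point $x^*$ (that is, $f(x^*)=0$), and every trajectory is bounded. (2) If some trajectory is precompact (has compact closure), then the system has at least one equilibrium point, and for every equilibrium point $p$ and every $d$ the norm ball $B_{p,d}=\{x\in\mathbb{R}^n : \|p-x\|\le d\}$ is compact and forward invariant, i.e. $\phi_t(B_{p,d})\subseteq B_{p,d}$ for all $t\ge 0$. -/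

import Mathlib

namespace NonexpansiveSystem

variable {E : Type*} [NormedAddCommGroup E] [NormedSpace ℝ E]

/-- `φ` is the forward time evolution of the autonomous system `x' = f x`, with state space all
of `E`: for every initial point `x` the curve `t ↦ φ t x` starts at `x` and solves the equation
at every time `t ≥ 0` (at `t = 0` through the right derivative).
Values of `φ` at negative times are irrelevant. -/
structure IsForwardFlow (f : E → E) (φ : ℝ → E → E) : Prop where
  map_zero : ∀ x : E, φ 0 x = x
  hasDerivWithinAt : ∀ x : E, ∀ t : ℝ, 0 ≤ t →
    HasDerivWithinAt (fun s : ℝ => φ s x) (f (φ t x)) (Set.Ici 0) t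

/-- The flow does not increase distances measured in the given norm. -/
def IsNonexpansive (φ : ℝ → E → E) : Prop :=
  ∀ t : ℝ, 0 < t → ∀ x y : E, ‖φ t x - φ t y‖ ≤ ‖x - y‖

/-- The (forward) trajectory of the point `x`, as a subset of the state space. -/
def trajectory (φ : ℝ → E → E) (x : E) : Set E :=
  (fun t : ℝ => φ t x) '' Set.Ici 0

/-- `p` is an equilibrium of the system `x' = f x`. -/
def IsEquilibrium (f : E → E) (p : E) : Prop := f p = 0

end NonexpansiveSystem

open Set Filter Topology

namespace NonexpansiveSystem

/-! A bounded trajectory forces an equilibrium. The points that stay within `r` of the trajectory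
from some time on form a bounded convex forward invariant set, whose closure is compact
(`exists_compact_convex_invariant`). On it each map `φ (2⁻ⁿ)` has a fixed point; these fixed-point
sets are compact and nested, so some `p` is fixed at all times `2⁻ⁿ`, and the derivative at `0`
gives `f p = 0`. Conversely, by uniqueness an equilibrium stays fixed, so nonexpansiveness preserves
every ball around it and bounds all trajectories. -/

/-- A nonexpansive self-map of a nonempty compact convex set has a fixed point. -/
theorem exists_fixedPoint_of_nonexpansive {E : Type*} [NormedAddCommGroup E] [NormedSpace ℝ E]
    {K : Set E} (hK : IsCompact K) (hconv : Convex ℝ K) (hKne : K.Nonempty) {g : E → E}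
    (hmaps : MapsTo g K K) (hg : ∀ x y, ‖g x - g y‖ ≤ ‖x - y‖) : ∃ x ∈ K, g x = x := by
  have hgc : Continuous g :=
    (LipschitzWith.of_dist_le_mul (K := 1) fun x y => by
      simpa [dist_eq_norm] using hg x y).continuous
  obtain ⟨x₀, hx₀⟩ := hKne
  obtain ⟨p, hpK, hp⟩ := hK.exists_isMinOn ⟨x₀, hx₀⟩
    (f := fun x => ‖g x - x‖) (by fun_prop)
  obtain ⟨D, hD⟩ := hK.isBounded.exists_norm_le
  have key : ∀ ε : ℝ, 0 < ε → ε < 1 → ‖g p - p‖ ≤ ε * (2 * D) := by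
    intro ε hε hε1
    -- Contracting `g` towards `x₀` gives a Banach fixed point that `g` displaces by at most `ε * (2
    -- * D)`; the minimal displacement, attained at `p`, is no larger.
    let F : E → E := fun x => (1 - ε) • g x + ε • x₀
    have hF : MapsTo F K K := fun x hx =>
      hconv (hmaps hx) hx₀ (by linarith) hε.le (by ring)
    have hcontr : ContractingWith (Real.toNNReal (1 - ε)) (hF.restrict F K K) := by
      refine ⟨?_, LipschitzWith.of_dist_le_mul fun x y => ?_⟩
      · rw [Real.toNNReal_lt_one]
        linarith
      · rw [Real.coe_toNNReal _ (by linarith), Subtype.dist_eq, Subtype.dist_eq, dist_eq_norm, dist_eq_norm]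
        change ‖((1 - ε) • g x + ε • x₀) - ((1 - ε) • g y + ε • x₀)‖ ≤ (1 - ε) * _
        rw [add_sub_add_right_eq_sub, ← smul_sub, norm_smul, Real.norm_of_nonneg (by linarith)]
        exact mul_le_mul_of_nonneg_left (hg _ _) (by linarith)
    obtain ⟨y, hyK, hy, -, -⟩ :=
      hcontr.exists_fixedPoint' hK.isComplete hF hx₀ (edist_ne_top _ _)
    have hy' : (1 - ε) • g y + ε • x₀ = y := hy
    have hdiff : g y - y = ε • (g y - x₀) := by
      nth_rewrite 2 [← hy']
      module
    calc ‖g p - p‖ ≤ ‖g y - y‖ := hp hyK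
      _ = ε * ‖g y - x₀‖ := by rw [hdiff, norm_smul, Real.norm_of_nonneg hε.le]
      _ ≤ ε * (2 * D) := by
        refine mul_le_mul_of_nonneg_left ((norm_sub_le _ _).trans ?_) hε.le
        linarith [hD _ (hmaps hyK), hD _ hx₀]
  refine ⟨p, hpK, sub_eq_zero.1 (norm_le_zero_iff.1 ?_)⟩
  have hlim : Tendsto (fun ε : ℝ => ε * (2 * D)) (𝓝[>] 0) (𝓝 0) := by
    have : Tendsto (fun ε : ℝ => ε * (2 * D)) (𝓝 0) (𝓝 (0 * (2 * D))) := by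
      exact (continuous_id.mul continuous_const).tendsto 0
    rw [zero_mul] at this
    exact this.mono_left nhdsWithin_le_nhds
  refine ge_of_tendsto hlim ?_
  filter_upwards [Ioo_mem_nhdsGT (zero_lt_one (α := ℝ))] with ε hε using key ε hε.1 hε.2

section

variable {E : Type*} [NormedAddCommGroup E] [NormedSpace ℝ E]
  {f : E → E} {φ : ℝ → E → E}

theorem IsNonexpansive.norm_sub_le (hne : IsNonexpansive φ) (hφ : IsForwardFlow f φ) {t : ℝ}
    (ht : 0 ≤ t) (x y : E) : ‖φ t x - φ t y‖ ≤ ‖x - y‖ := by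
  rcases ht.eq_or_lt with rfl | ht
  · simp [hφ.map_zero]
  · exact hne t ht x y

/-- A point fixed by the flow at the times `(1 / 2) ^ n` is an equilibrium. -/
theorem IsForwardFlow.isEquilibrium_of_fixed (hφ : IsForwardFlow f φ) {p : E}
    (hp : ∀ n : ℕ, φ ((1 / 2) ^ n) p = p) : IsEquilibrium f p := by
  have h := hφ.hasDerivWithinAt p 0 le_rfl
  rw [hφ.map_zero, hasDerivWithinAt_iff_tendsto_slope] at h
  have hseq : Tendsto (fun n : ℕ => ((1 / 2 : ℝ)) ^ n) atTop (𝓝[Ici 0 \ {0}] 0) := by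
    refine tendsto_nhdsWithin_iff.2
      ⟨tendsto_pow_atTop_nhds_zero_of_lt_one (by norm_num) (by norm_num), ?_⟩
    refine Eventually.of_forall fun n => ?_
    have : (0 : ℝ) < (1 / 2) ^ n := by positivity
    exact ⟨this.le, this.ne'⟩
  refine tendsto_nhds_unique (h.comp hseq) ?_
  have : (slope (fun s => φ s p) 0 ∘ fun n : ℕ => ((1 / 2 : ℝ)) ^ n) = fun _ => 0 := by
    funext n
    simp only [Function.comp_apply, slope_def_module, hp n, hφ.map_zero, sub_self, smul_zero]
  rw [this]
  exact tendsto_const_nhds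

/-- Forward solutions of a `C¹` system are unique. -/
theorem forward_solution_unique [FiniteDimensional ℝ E] (hf : ContDiff ℝ 1 f) {u v : ℝ → E}
    (hu : ∀ t, 0 ≤ t → HasDerivWithinAt u (f (u t)) (Ici 0) t)
    (hv : ∀ t, 0 ≤ t → HasDerivWithinAt v (f (v t)) (Ici 0) t)
    (h0 : u 0 = v 0) {t : ℝ} (ht : 0 ≤ t) : u t = v t := by
  have huc : ContinuousOn u (Icc 0 t) := fun s hs =>
    (hu s hs.1).continuousWithinAt.mono Icc_subset_Ici_self
  have hvc : ContinuousOn v (Icc 0 t) := fun s hs =>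
    (hv s hs.1).continuousWithinAt.mono Icc_subset_Ici_self
  -- `f` is only locally Lipschitz, so both curves on `[0, t]` are first enclosed in one ball.
  obtain ⟨R, hR⟩ := (((isCompact_Icc.image_of_continuousOn huc).union
    (isCompact_Icc.image_of_continuousOn hvc)).isBounded).subset_closedBall (0 : E)
  obtain ⟨K, hK⟩ := hf.contDiffOn.exists_lipschitzOnWith one_ne_zero
    (convex_closedBall (0 : E) R) (isCompact_closedBall (0 : E) R)
  exact ODE_solution_unique_of_mem_Icc_right (v := fun _ => f)
    (s := fun _ => Metric.closedBall (0 : E) R) (fun _ _ => hK) huc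
    (fun s hs => (hu s hs.1).mono (Ici_subset_Ici.2 hs.1))
    (fun s hs => hR (Or.inl (mem_image_of_mem _ (Ico_subset_Icc_self hs)))) hvc
    (fun s hs => (hv s hs.1).mono (Ici_subset_Ici.2 hs.1))
    (fun s hs => hR (Or.inr (mem_image_of_mem _ (Ico_subset_Icc_self hs)))) h0 ⟨ht, le_rfl⟩

variable [FiniteDimensional ℝ E]

theorem IsForwardFlow.map_add (hφ : IsForwardFlow f φ) (hf : ContDiff ℝ 1 f) {s t : ℝ}
    (hs : 0 ≤ s) (ht : 0 ≤ t) (x : E) : φ (s + t) x = φ s (φ t x) := by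
  refine forward_solution_unique hf (u := fun s => φ (s + t) x) (v := fun s => φ s (φ t x))
    (fun s hs => ?_) (fun s hs => hφ.hasDerivWithinAt _ s hs) (by simp [hφ.map_zero]) hs
  have h := (hφ.hasDerivWithinAt x (s + t) (by positivity)).scomp s
    (((hasDerivAt_id s).add_const t).hasDerivWithinAt (s := Ici 0))
    (fun r hr => add_nonneg (mem_Ici.1 hr) ht)
  simpa [Function.comp_def] using h

theorem IsForwardFlow.map_equilibrium (hφ : IsForwardFlow f φ) (hf : ContDiff ℝ 1 f) {p : E}
    (hp : IsEquilibrium f p) {t : ℝ} (ht : 0 ≤ t) : φ t p = p := by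
  refine forward_solution_unique hf (u := fun s => φ s p) (v := fun _ => p)
    (fun s hs => hφ.hasDerivWithinAt _ s hs) (fun s _ => ?_) (hφ.map_zero p) ht
  rw [show f p = 0 from hp]
  exact hasDerivWithinAt_const _ _ _

/-- A nonexpansive flow with a bounded trajectory leaves a nonempty compact convex set forward
invariant. -/
theorem exists_compact_convex_invariant (hφ : IsForwardFlow f φ) (hf : ContDiff ℝ 1 f)
    (hne : IsNonexpansive φ) {x : E} (hx : Bornology.IsBounded (trajectory φ x)) :
    ∃ K : Set E, IsCompact K ∧ Convex ℝ K ∧ K.Nonempty ∧ ∀ t, 0 ≤ t → MapsTo (φ t) K K := by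
  obtain ⟨r, hr⟩ := hx.subset_closedBall x
  -- The condition `0 ≤ s` keeps `τ - t` nonnegative in `hAmaps`, where the semigroup law is
  -- applied. The sets with `s ≥ 0` increase with `s`, so their union is convex.
  let A : ℝ → Set E := fun s => {y | 0 ≤ s ∧ ∀ t, s ≤ t → ‖φ t x - y‖ ≤ r}
  have hA : ∀ s, 0 ≤ s → x ∈ A s := fun s hs => ⟨hs, fun t ht => by
    simpa [dist_eq_norm] using hr (mem_image_of_mem _ (mem_Ici.2 (hs.trans ht)))⟩
  have hAmaps : ∀ s t, 0 ≤ t → MapsTo (φ t) (A s) (A (s + t)) := fun s t ht y hy =>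
    ⟨add_nonneg hy.1 ht, fun τ hτ => by
      have h1 : φ τ x = φ t (φ (τ - t) x) := by
        rw [← hφ.map_add hf ht (by linarith [hy.1]), add_sub_cancel]
      rw [h1]
      exact (hne.norm_sub_le hφ ht _ _).trans (hy.2 _ (by linarith))⟩
  have hbdd : Bornology.IsBounded (⋃ s, A s) := by
    refine Metric.isBounded_closedBall (x := x) (r := r + r) |>.subset ?_
    refine iUnion_subset fun s y hy => ?_
    have h1 := hy.2 s le_rfl
    have h2 := (hA s hy.1).2 s le_rfl
    rw [Metric.mem_closedBall, dist_eq_norm]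
    calc ‖y - x‖ = ‖(φ s x - x) - (φ s x - y)‖ := by congr 1; abel
      _ ≤ r + r := (_root_.norm_sub_le _ _).trans (add_le_add h2 h1)
  refine ⟨closure (⋃ s, A s), hbdd.isCompact_closure, Convex.closure ?_,
    ⟨x, subset_closure (mem_iUnion.2 ⟨0, hA 0 le_rfl⟩)⟩, fun t ht => MapsTo.closure ?_ ?_⟩
  · intro y hy z hz a b ha hb hab
    obtain ⟨s, hs⟩ := mem_iUnion.1 hy
    obtain ⟨s', hs'⟩ := mem_iUnion.1 hz
    refine mem_iUnion.2 ⟨max s s', le_max_of_le_left hs.1, fun t ht => ?_⟩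
    have h1 := hs.2 t ((le_max_left _ _).trans ht)
    have h2 := hs'.2 t ((le_max_right _ _).trans ht)
    rw [← dist_eq_norm, dist_comm] at h1 h2 ⊢
    exact convex_closedBall (φ t x) r h1 h2 ha hb hab
  · intro y hy
    obtain ⟨s, hs⟩ := mem_iUnion.1 hy
    exact mem_iUnion.2 ⟨s + t, hAmaps s t ht hs⟩
  · exact (LipschitzWith.of_dist_le_mul (K := 1) fun y z => by
      simpa [dist_eq_norm] using hne.norm_sub_le hφ ht y z).continuous

/-- A nonexpansive system with a bounded trajectory has an equilibrium. -/
theorem exists_isEquilibrium (hφ : IsForwardFlow f φ) (hf : ContDiff ℝ 1 f)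
    (hne : IsNonexpansive φ) {x : E} (hx : Bornology.IsBounded (trajectory φ x)) :
    ∃ p, IsEquilibrium f p := by
  obtain ⟨K, hK, hconv, hKne, hinv⟩ := exists_compact_convex_invariant hφ hf hne hx
  have hpos : ∀ n : ℕ, (0 : ℝ) ≤ (1 / 2) ^ n := fun n => by positivity
  have hclosed : ∀ n : ℕ, IsClosed (K ∩ {y | φ ((1 / 2) ^ n) y = y}) := fun n =>
    hK.isClosed.inter <| isClosed_eq
      (LipschitzWith.of_dist_le_mul (K := 1) fun y z => by
        simpa [dist_eq_norm] using hne.norm_sub_le hφ (hpos n) y z).continuous continuous_id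
  -- The sets decrease in `n`: a point fixed at time `2⁻⁽ⁿ⁺¹⁾` is fixed at twice that time.
  obtain ⟨p, hp⟩ := IsCompact.nonempty_iInter_of_sequence_nonempty_isCompact_isClosed
    (fun n : ℕ => K ∩ {y | φ ((1 / 2) ^ n) y = y})
    (fun n y hy => ⟨hy.1, by
      have h2 : φ ((1 / 2) ^ (n + 1)) y = y := hy.2
      have h3 : ((1 / 2 : ℝ)) ^ n = (1 / 2) ^ (n + 1) + (1 / 2) ^ (n + 1) := by ring
      change φ ((1 / 2) ^ n) y = y
      rw [h3, hφ.map_add hf (hpos _) (hpos _), h2, h2]⟩)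
    (fun n => exists_fixedPoint_of_nonexpansive hK hconv hKne (hinv _ (hpos n))
      (hne.norm_sub_le hφ (hpos n)))
    (hK.of_isClosed_subset (hclosed 0) inter_subset_left) hclosed
  exact ⟨p, hφ.isEquilibrium_of_fixed fun n => (mem_iInter.1 hp n).2⟩

theorem mapsTo_closedBall (hφ : IsForwardFlow f φ) (hf : ContDiff ℝ 1 f)
    (hne : IsNonexpansive φ) {p : E} (hp : IsEquilibrium f p) (d : ℝ) {t : ℝ} (ht : 0 ≤ t) :
    MapsTo (φ t) (Metric.closedBall p d) (Metric.closedBall p d) := by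
  intro x hx
  rw [Metric.mem_closedBall, dist_eq_norm] at hx ⊢
  have h := hne.norm_sub_le hφ ht x p
  rw [hφ.map_equilibrium hf hp ht] at h
  exact h.trans hx

theorem isBounded_trajectory (hφ : IsForwardFlow f φ) (hf : ContDiff ℝ 1 f)
    (hne : IsNonexpansive φ) {p : E} (hp : IsEquilibrium f p) (x : E) :
    Bornology.IsBounded (trajectory φ x) := by
  refine (Metric.isBounded_closedBall (x := p) (r := dist x p)).subset ?_
  rintro _ ⟨t, ht, rfl⟩
  exact mapsTo_closedBall hφ hf hne hp _ ht (Metric.mem_closedBall.2 le_rfl)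

end

end NonexpansiveSystem

theorem mainTheorem3 {E : Type*} [NormedAddCommGroup E] [NormedSpace ℝ E]
    [FiniteDimensional ℝ E] (f : E → E) (hf : ContDiff ℝ 1 f) (φ : ℝ → E → E)
    (hφ : NonexpansiveSystem.IsForwardFlow f φ)
    (hne : NonexpansiveSystem.IsNonexpansive φ) :
    Xor (∀ x : E, ¬ Bornology.IsBounded (NonexpansiveSystem.trajectory φ x))
      ((∃ p : E, NonexpansiveSystem.IsEquilibrium f p) ∧
        ∀ x : E, Bornology.IsBounded (NonexpansiveSystem.trajectory φ x)) ∧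
    ((∃ x : E, IsCompact (closure (NonexpansiveSystem.trajectory φ x))) →
      (∃ p : E, NonexpansiveSystem.IsEquilibrium f p) ∧
        ∀ p : E, NonexpansiveSystem.IsEquilibrium f p → ∀ d : ℝ,
          IsCompact (Metric.closedBall p d) ∧
            IsForwardInvariant φ (Metric.closedBall p d)) := by
  refine ⟨?_, ?_⟩
  · by_cases h : ∀ x : E, ¬ Bornology.IsBounded (NonexpansiveSystem.trajectory φ x)
    · exact Or.inl ⟨h, fun h' => h 0 (h'.2 0)⟩
    · refine Or.inr ⟨?_, h⟩
      push Not at h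
      obtain ⟨x, hx⟩ := h
      obtain ⟨p, hp⟩ := NonexpansiveSystem.exists_isEquilibrium hφ hf hne hx
      exact ⟨⟨p, hp⟩, NonexpansiveSystem.isBounded_trajectory hφ hf hne hp⟩
  · rintro ⟨x, hx⟩
    exact ⟨NonexpansiveSystem.exists_isEquilibrium hφ hf hne (hx.isBounded.subset subset_closure),
      fun p hp d => ⟨isCompact_closedBall p d, fun t ht =>
        NonexpansiveSystem.mapsTo_closedBall hφ hf hne hp d ht⟩⟩
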